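/- Let $\mathfrak g$ be a finite-dimensional simple real Lie algebra with Killing form $\langle\cdot,\cdot\rangle$, let $\mathfrak t\subset\mathfrak g$ be a Cartan subalgebra, and let $\Theta$ be a Cartan involution of $\mathfrak g$, that is, an involutive automorphism (possibly the identity) such that $-\langle X,\Theta Y\rangle$ is positive definite, with $\Theta(\mathfrak t)=\mathfrak t$. Write $\mathfrak g^{\mathbb C}=\mathbb C\otimes_{\mathbb R}\mathfrak g$ and $\mathfrak t^{\mathbb C}=\mathbb C\otimes_{\mathbb R}\mathfrak t$, and extend $\Theta$ complex-linearly to $\mathfrak g^{\mathbb C}$; it acts on functionals $\alpha$ on $\mathfrak t^{\mathbb C}$ by $\Theta(\alpha)(X)=\alpha(\Theta X)$. Choose simple roots $\alpha_1,\dots,\alpha_N$ for the root system $\Delta=\Delta(\mathfrak g^{\mathbb C},\mathfrak t^{\mathbb C})$, let $\eta_1,\dots,\eta_N$ be the dual basis of $\mathfrak t^{\mathbb C}$, so that $\alpha_i(\eta_j)=\delta_{ij}$, let $k-1$ be the maximal height of a root (the height of $\sum_j m_j\alpha_j$ being $\sum_j m_j$), and let $$\sigma=\operatorname{Ad}_{\exp\left(\frac{2\pi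 i}{k}\sum_{j=1}^N\eta_j\right)}=\exp\Bigl(\operatorname{ad}\bigl(\tfrac{2\pi i}{k}\textstyle\sum_{j=1}^N\eta_j\bigr)\Bigr)$$ be the corresponding Coxeter automorphism of $\mathfrak g^{\mathbb C}$. Then the following are equivalent: 1. $\sigma$ preserves the real form $\mathfrak g$, i.e. $\sigma(\mathfrak g)=\mathfrak g$; 2. $\sigma$ commutes with $\Theta$ on $\mathfrak g^{\mathbb C}$; 3. $\Theta$ defines a permutation of the extended Dynkin diagram, i.e. it permutes the set consisting of the simple roots $\alpha_1,\dots,\alpha_N$ and the lowest root $\alpha_0$ (the minimal root for the order in which $\beta\le\alpha$ means that $\alpha-\beta$ is a sum of simple roots), and this permutation preserves the Cartan integers between these roots. Here, if $\mathfrak g^{\mathbb C}$ is not simple (that is, if $\mathfrak g$ is a complex simple Lie algebra regarded as a real one), the extended Dynkin diagram contains the minimal root of each of the irreducible components of $\Delta$ in place of the single root $\alpha_0$. -/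

import Mathlib

noncomputable section

open scoped TensorProduct
open LieAlgebra LieAlgebra.IsKilling

namespace CoxeterReal

section RealForms

variable {𝔤 : Type*} [LieRing 𝔤] [LieAlgebra ℝ 𝔤]

/-- The complexification of a real Lie subalgebra, as a subalgebra of the complexification. -/
def complexify (𝔱 : LieSubalgebra ℝ 𝔤) : LieSubalgebra ℂ (ℂ ⊗[ℝ] 𝔤) :=
  { (𝔱.toSubmodule).baseChange ℂ with
    lie_mem' := by
      intro x y hx hy
      change x ∈ 𝔱.toSubmodule.baseChange ℂ at hx
      change y ∈ 𝔱.toSubmodule.baseChange ℂ at hy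
      change ⁅x, y⁆ ∈ 𝔱.toSubmodule.baseChange ℂ
      rw [Submodule.baseChange_eq_span] at hx hy
      induction hx using Submodule.span_induction with
      | zero => simp
      | add x₁ x₂ _ _ h₁ h₂ => rw [add_lie]; exact add_mem h₁ h₂
      | smul c x _ h => rw [smul_lie]; exact Submodule.smul_mem _ _ h
      | mem x hx =>
        induction hy using Submodule.span_induction with
        | zero => convert Submodule.zero_mem _; exact lie_zero x
        | add x₁ x₂ _ _ h₁ h₂ => rw [LieRing.lie_add]; exact add_mem h₁ h₂
        | smul c x _ h => rw [LieAlgebra.lie_smul]; exact Submodule.smul_mem _ _ h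
        | mem y hy =>
          obtain ⟨a, ha, rfl⟩ := hx
          obtain ⟨b, hb, rfl⟩ := hy
          simp only [TensorProduct.mk_apply, ExtendScalars.bracket_tmul, mul_one]
          exact Submodule.tmul_mem_baseChange_of_mem _ (𝔱.lie_mem ha hb) }

theorem mem_complexify_iff (𝔱 : LieSubalgebra ℝ 𝔤) (x : ℂ ⊗[ℝ] 𝔤) :
    x ∈ complexify 𝔱 ↔ x ∈ 𝔱.toSubmodule.baseChange ℂ := Iff.rfl

/-- A Cartan involution: an involutive automorphism `Θ` such that `-⟨X, Θ Y⟩` is positive definite,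
where `⟨·, ·⟩` is the Killing form. -/
structure IsCartanInvolution (Θ : 𝔤 →ₗ⁅ℝ⁆ 𝔤) : Prop where
  involutive : ∀ x, Θ (Θ x) = x
  posDef : ∀ x, x ≠ 0 → 0 < -killingForm ℝ 𝔤 x (Θ x)

/-- The complex-linear extension of an endomorphism of `𝔤` to the complexification. -/
def extend (Θ : 𝔤 →ₗ⁅ℝ⁆ 𝔤) : Module.End ℂ (ℂ ⊗[ℝ] 𝔤) :=
  (Θ : 𝔤 →ₗ[ℝ] 𝔤).baseChange ℂ

variable (𝔤) in
/-- The copy `1 ⊗ 𝔤` of `𝔤` in its complexification. -/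
def realForm : Submodule ℝ (ℂ ⊗[ℝ] 𝔤) :=
  LinearMap.range (TensorProduct.mk ℝ ℂ 𝔤 1)

theorem extend_mem (𝔱 : LieSubalgebra ℝ 𝔤) (Θ : 𝔤 →ₗ⁅ℝ⁆ 𝔤) (h : ∀ x ∈ 𝔱, Θ x ∈ 𝔱) :
    ∀ x ∈ (complexify 𝔱).toSubmodule, extend Θ x ∈ (complexify 𝔱).toSubmodule := by
  intro x hx
  change x ∈ 𝔱.toSubmodule.baseChange ℂ at hx
  change extend Θ x ∈ 𝔱.toSubmodule.baseChange ℂ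
  rw [Submodule.baseChange_eq_span] at hx
  induction hx using Submodule.span_induction with
  | zero => simp
  | add x₁ x₂ _ _ h₁ h₂ => rw [map_add]; exact add_mem h₁ h₂
  | smul c x _ h => rw [map_smul]; exact Submodule.smul_mem _ _ h
  | mem x hx =>
    obtain ⟨a, ha, rfl⟩ := hx
    exact Submodule.tmul_mem_baseChange_of_mem _ (h a ha)

/-- The action of `Θ` on functionals on `𝔱^ℂ`, namely `Θ(α)(X) = α(Θ X)`. -/
def dualAction (𝔱 : LieSubalgebra ℝ 𝔤) (Θ : 𝔤 →ₗ⁅ℝ⁆ 𝔤) (h : ∀ x ∈ 𝔱, Θ x ∈ 𝔱) :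
    Module.Dual ℂ (complexify 𝔱) →ₗ[ℂ] Module.Dual ℂ (complexify 𝔱) :=
  Module.Dual.transpose (R := ℂ) ((extend Θ).restrict (extend_mem 𝔱 Θ h))

theorem exists_eq_add (x : ℂ ⊗[ℝ] 𝔤) :
    ∃ a b : 𝔤, x = (1 : ℂ) ⊗ₜ[ℝ] a + Complex.I ⊗ₜ[ℝ] b := by
  induction x using TensorProduct.induction_on with
  | zero => exact ⟨0, 0, by simp⟩
  | tmul c a =>
    refine ⟨c.re • a, c.im • a, ?_⟩
    rw [← TensorProduct.smul_tmul, ← TensorProduct.smul_tmul, ← TensorProduct.add_tmul]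
    congr 1
    apply Complex.ext <;> simp
  | add x y hx hy =>
    obtain ⟨a, b, rfl⟩ := hx
    obtain ⟨c, d, rfl⟩ := hy
    exact ⟨a + c, b + d, by simp only [TensorProduct.tmul_add]; abel⟩

theorem mem_of_add_mem_complexify (𝔱 : LieSubalgebra ℝ 𝔤) {a b : 𝔤}
    (h : (1 : ℂ) ⊗ₜ[ℝ] a + Complex.I ⊗ₜ[ℝ] b ∈ complexify 𝔱) : a ∈ 𝔱 ∧ b ∈ 𝔱 := by
  have key : ∀ (f : ℂ →ₗ[ℝ] ℝ) (x : ℂ ⊗[ℝ] 𝔤), x ∈ complexify 𝔱 →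
      TensorProduct.lid ℝ 𝔤 (f.rTensor 𝔤 x) ∈ 𝔱 := by
    intro f x hx
    obtain ⟨y, rfl⟩ := hx
    induction y using TensorProduct.induction_on with
    | zero => simp
    | tmul c z => simpa using 𝔱.smul_mem (f c) z.2
    | add y z hy hz => simpa only [map_add] using 𝔱.add_mem hy hz
  constructor
  · simpa using key Complex.reLm _ h
  · simpa using key Complex.imLm _ h

instance isKilling_complexification [FiniteDimensional ℝ 𝔤] [LieAlgebra.IsKilling ℝ 𝔤] :
    LieAlgebra.IsKilling ℂ (ℂ ⊗[ℝ] 𝔤) := by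
  constructor
  rw [eq_bot_iff]
  intro x hx
  obtain ⟨a, b, rfl⟩ := exists_eq_add x
  rw [LieIdeal.mem_killingCompl] at hx
  have h (y : 𝔤) : killingForm ℝ 𝔤 a y = 0 ∧ killingForm ℝ 𝔤 b y = 0 := by
    have := hx ((1 : ℂ) ⊗ₜ[ℝ] y) trivial
    rw [LieModule.traceForm_comm, LieModule.traceForm_baseChange] at this
    have h' := Complex.ext_iff.mp this
    simpa using h'
  have hz (c : 𝔤) (hc : ∀ y, killingForm ℝ 𝔤 c y = 0) : c = 0 := by
    have : c ∈ LinearMap.ker (killingForm ℝ 𝔤) := LinearMap.ext hc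
    simpa using this
  simp [hz a fun y => (h y).1, hz b fun y => (h y).2]

instance isCartanSubalgebra_complexify (𝔱 : LieSubalgebra ℝ 𝔤) [𝔱.IsCartanSubalgebra] :
    (complexify 𝔱).IsCartanSubalgebra where
  nilpotent := by
    let f : ℂ ⊗[ℝ] 𝔱 →ₗ⁅ℂ⁆ complexify 𝔱 :=
      { (𝔱.toSubmodule.subtype.baseChange ℂ).codRestrict (complexify 𝔱).toSubmodule
          (fun x => LinearMap.mem_range_self _ x) with
        map_lie' := by
          intro x y
          apply Subtype.ext
          change (𝔱.toSubmodule.subtype.baseChange ℂ) ⁅x, y⁆ =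
            ⁅(𝔱.toSubmodule.subtype.baseChange ℂ) x, (𝔱.toSubmodule.subtype.baseChange ℂ) y⁆
          induction x using TensorProduct.induction_on with
          | zero => simp
          | add x₁ x₂ h₁ h₂ => simp only [add_lie, map_add, h₁, h₂]
          | tmul c u =>
            induction y using TensorProduct.induction_on with
            | zero =>
              rw [map_zero]
              exact (congrArg _ (lie_zero (c ⊗ₜ[ℝ] u))).trans ((map_zero _).trans (lie_zero _).symm)
            | add x₁ x₂ h₁ h₂ => simp only [LieRing.lie_add, map_add, h₁, h₂]
            | tmul d v => simp }
    have hf : Function.Surjective f := by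
      rintro ⟨_, y, rfl⟩
      exact ⟨y, rfl⟩
    exact hf.lieAlgebra_isNilpotent
  self_normalizing := by
    refine le_antisymm ?_ (LieSubalgebra.le_normalizer _)
    intro x hx
    obtain ⟨a, b, rfl⟩ := exists_eq_add x
    rw [LieSubalgebra.mem_normalizer_iff] at hx
    have h (y : 𝔤) (hy : y ∈ 𝔱) : ⁅a, y⁆ ∈ 𝔱 ∧ ⁅b, y⁆ ∈ 𝔱 := by
      apply mem_of_add_mem_complexify
      have := hx ((1 : ℂ) ⊗ₜ[ℝ] y) (Submodule.tmul_mem_baseChange_of_mem _ hy)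
      simpa [add_lie] using this
    have hn (c : 𝔤) (hc : ∀ y ∈ 𝔱, ⁅c, y⁆ ∈ 𝔱) : c ∈ 𝔱 := by
      rw [← LieSubalgebra.IsCartanSubalgebra.self_normalizing (H := 𝔱),
        LieSubalgebra.mem_normalizer_iff]
      exact hc
    exact add_mem (Submodule.tmul_mem_baseChange_of_mem _ (hn a fun y hy => (h y hy).1))
      (Submodule.tmul_mem_baseChange_of_mem _ (hn b fun y hy => (h y hy).2))

end RealForms

section Coxeter

/-- The exponential of an endomorphism of a finite-dimensional complex vector space, computed as
a matrix exponential in a basis (the result does not depend on the basis). -/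
def endExp {V : Type*} [AddCommGroup V] [Module ℂ V] [FiniteDimensional ℂ V]
    (f : Module.End ℂ V) : Module.End ℂ V :=
  Matrix.toLin (Module.finBasis ℂ V) (Module.finBasis ℂ V)
    (NormedSpace.exp (LinearMap.toMatrix (Module.finBasis ℂ V) (Module.finBasis ℂ V) f))

variable {L : Type*} [LieRing L] [LieAlgebra ℂ L] [FiniteDimensional ℂ L]
  [LieAlgebra.IsKilling ℂ L] {H : LieSubalgebra ℂ L} [H.IsCartanSubalgebra]

/-- The basis of the Cartan subalgebra dual to the simple roots. -/
def dualVector (b : (rootSystem H).Base) (j : b.support) : H :=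
  (Module.evalEquiv ℂ H).symm (b.toWeightBasis.coord j)

/-- One more than the maximal height of a root. -/
def coxeterNumber (b : (rootSystem H).Base) : ℤ :=
  (⨆ i, b.height i) + 1

/-- The Coxeter automorphism `Ad (exp M) = exp (ad M)`, where `M = (2πi/k) ∑ⱼ ηⱼ`. -/
def coxeterAut (b : (rootSystem H).Base) : Module.End ℂ L :=
  endExp (LieAlgebra.ad ℂ L
    (((2 * Real.pi * Complex.I / (coxeterNumber b : ℂ)) • ∑ j, dualVector b j : H) : L))

/-- The lowest roots: those that are minimal for the partial order in which `β ≤ α` if `α - β` is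
a sum of simple roots. Each irreducible component of the root system has exactly one. -/
def IsLowest (b : (rootSystem H).Base) (i : H.root) : Prop :=
  ∀ j, (rootSystem H).root i - (rootSystem H).root j ∈
    AddSubmonoid.closure ((rootSystem H).root '' b.support) → j = i

/-- The nodes of the extended Dynkin diagram: the simple roots together with the lowest root. -/
def extendedNodes (b : (rootSystem H).Base) : Set H.root :=
  {i | i ∈ b.support ∨ IsLowest b i}

/-- A linear map of the dual of the Cartan subalgebra defines a permutation of the extended Dynkin
diagram: it permutes the nodes and respects the Cartan integers, hence all the edges. -/
def PermutesExtendedDiagram (b : (rootSystem H).Base)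
    (φ : Module.Dual ℂ H →ₗ[ℂ] Module.Dual ℂ H) : Prop :=
  ∃ π : Equiv.Perm (extendedNodes b),
    (∀ i : extendedNodes b, φ ((rootSystem H).root i) = (rootSystem H).root (π i)) ∧
    ∀ i j : extendedNodes b,
      (rootSystem H).pairing (π i) (π j) = (rootSystem H).pairing i j

end Coxeter

end CoxeterReal

end

/-! Put M = (2πi/k) ∑ ηⱼ, so that `coxeterAut` acts on the root space of α by exp(α(M)) = exp(2πi
ht(α)/k). All three conditions are shown equivalent to one congruence: ht(Θα) ≡ ht(α) mod k for
every root α, written as exp(α(ΘM)) = exp(α(M)).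

Commuting with Θ: Θ maps the root space of α to that of Θα, so the scalars at α and Θα must agree
(`commute_extend_iff`). Preserving 𝔤: this means commuting with the conjugation, which maps the root
space of α to that of -Θα (`conj_mem_rootSpace`). The conjugation is antilinear and the scalars have
modulus one, so both sides of the condition get inverted and the same congruence results
(`map_realForm_coxeterAut_eq_iff`).

Permuting the diagram: heights lie strictly between -k and k, so the nodes are exactly the roots of
height ≡ 1 mod k (`mem_extendedNodes_iff`), once every lowest root is known to have height 1 - k.
The congruence then preserves the nodes; conversely it follows by linearity from its case of simple
roots (`permutesExtendedDiagram_iff`).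

If 𝔤^ℂ is not simple, its components must be shown to have highest roots of equal height. This is
done without decomposing Δ: ∑ⱼ |⟨α, αⱼ^∨⟩| is invariant under reflections and Θ and equals 4 ht(α)
for dominant α, while simplicity of 𝔤 makes every root non-orthogonal to the orbit of any given root
(`exists_pairing_ne_zero`, `IsLowest.height_eq`). -/

noncomputable section

open scoped TensorProduct
open LieAlgebra LieAlgebra.IsKilling

/-! ### Heights, maximal roots and an invariant that compares them across components. -/

namespace RootPairing.Base

open Set

variable {ι R M N : Type*} [CommRing R]
  [AddCommGroup M] [Module R M] [AddCommGroup N] [Module R N]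
  {P : RootPairing ι R M N}

/-- A root is maximal relative to a base if adding a nonzero sum of simple roots to it never gives
a root. -/
def IsMaximal (b : P.Base) (i : ι) : Prop :=
  ∀ j, P.root j - P.root i ∈ AddSubmonoid.closure (P.root '' b.support) → j = i

lemma exists_nat_of_mem_closure (b : P.Base) {x : M}
    (hx : x ∈ AddSubmonoid.closure (P.root '' b.support)) :
    ∃ f : ι → ℕ, x = ∑ j ∈ b.support, f j • P.root j := by
  classical
  induction hx using AddSubmonoid.closure_induction with
  | mem x hx =>
    obtain ⟨i, hi, rfl⟩ := hx
    refine ⟨Pi.single i 1, ?_⟩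
    rw [Finset.sum_eq_single_of_mem i hi (by simp_all)]
    simp
  | zero => exact ⟨0, by simp⟩
  | add x y _ _ hx hy =>
    obtain ⟨f, rfl⟩ := hx
    obtain ⟨g, rfl⟩ := hy
    exact ⟨f + g, by simp [add_smul, Finset.sum_add_distrib]⟩

section

variable [P.IsCrystallographic] [Fintype ι]

variable (P) in
/-- The sum of the absolute values of the Cartan integers `⟨αᵢ, αⱼ^∨⟩` over all `j`. -/
def absPairingSum (i : ι) : ℤ :=
  ∑ j, |P.pairingIn ℤ i j|

lemma absPairingSum_comp_equiv (e : ι ≃ ι)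
    (he : ∀ i j, P.pairingIn ℤ (e i) (e j) = P.pairingIn ℤ i j) (i : ι) :
    absPairingSum P (e i) = absPairingSum P i := by
  rw [absPairingSum, ← e.sum_comp, absPairingSum]
  simp_rw [he]

end

variable [CharZero R]

lemma height_le_of_sub_mem_closure (b : P.Base) {i j : ι}
    (h : P.root j - P.root i ∈ AddSubmonoid.closure (P.root '' b.support)) :
    b.height i ≤ b.height j ∧ (b.height i = b.height j → i = j) := by
  obtain ⟨f, hf⟩ := b.exists_nat_of_mem_closure h
  obtain ⟨g, -, -, hg⟩ := b.exists_root_eq_sum_int i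
  have hj : P.root j = ∑ k ∈ b.support, (g k + f k) • P.root k := by
    rw [sub_eq_iff_eq_add'.mp hf, hg, ← Finset.sum_add_distrib]
    simp [add_smul]
  have hsum : b.height j = b.height i + ∑ k ∈ b.support, (f k : ℤ) := by
    rw [height_eq_sum hj, height_eq_sum hg, Finset.sum_add_distrib]
  have hnn : 0 ≤ ∑ k ∈ b.support, (f k : ℤ) := Finset.sum_nonneg fun _ _ ↦ by positivity
  refine ⟨by omega, fun he ↦ ?_⟩
  have h0 : ∑ k ∈ b.support, (f k : ℤ) = 0 := by omega
  rw [Finset.sum_eq_zero_iff_of_nonneg fun _ _ ↦ by positivity] at h0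
  rw [Finset.sum_eq_zero fun k hk ↦ by
    rw [show f k = 0 by exact_mod_cast h0 k hk, zero_smul], sub_eq_zero] at hf
  exact (P.root.injective hf).symm

lemma root_mem_closure_of_isPos (b : P.Base) {i : ι} (hi : b.IsPos i) :
    P.root i ∈ AddSubmonoid.closure (P.root '' b.support) := by
  refine (b.root_mem_or_neg_mem i).resolve_right fun h ↦ ?_
  obtain ⟨f, hf⟩ := b.exists_nat_of_mem_closure h
  have hf' : P.root i = ∑ j ∈ b.support, (-(f j : ℤ)) • P.root j := by
    rw [← neg_neg (P.root i), hf]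
    simp
  have := (isPos_iff b).mp hi
  rw [height_eq_sum hf', Finset.sum_neg_distrib] at this
  have hnn : 0 ≤ ∑ k ∈ b.support, (f k : ℤ) := Finset.sum_nonneg fun _ _ ↦ by positivity
  omega

/-- A root of height one is simple. -/
lemma mem_support_of_height_eq_one (b : P.Base) {i : ι} (hi : b.height i = 1) :
    i ∈ b.support := by
  classical
  obtain ⟨f, hf⟩ := b.exists_nat_of_mem_closure
    (b.root_mem_closure_of_isPos (i := i) ((isPos_iff b).mpr (by omega)))
  have hsum : ∑ k ∈ b.support, f k = 1 := by
    have h := height_eq_sum (b := b) (f := fun k ↦ (f k : ℤ)) (by simpa using hf)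
    rw [hi] at h
    exact_mod_cast h.symm
  obtain ⟨j, hj, hj0⟩ : ∃ j ∈ b.support, f j ≠ 0 := by
    by_contra! hcon
    rw [Finset.sum_eq_zero hcon] at hsum
    omega
  rw [← Finset.add_sum_erase _ _ hj] at hsum
  have h0 : ∑ k ∈ b.support.erase j, f k = 0 := by omega
  rw [Finset.sum_eq_zero_iff] at h0
  rw [← Finset.add_sum_erase _ _ hj, show f j = 1 by omega,
    Finset.sum_eq_zero fun k hk ↦ by rw [h0 k hk, zero_smul], one_smul, add_zero] at hf
  rwa [P.root.injective hf]

variable [P.IsCrystallographic]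

lemma pairingIn_eq_sum_mul {i : ι} {s : Finset ι} {f : ι → ℤ}
    (h : P.root i = ∑ j ∈ s, f j • P.root j) (k : ι) :
    P.pairingIn ℤ i k = ∑ j ∈ s, f j * P.pairingIn ℤ j k :=
  FaithfulSMul.algebraMap_injective ℤ R <| by
    simp_rw [algebraMap_pairingIn, map_sum, ← root_coroot_eq_pairing, h, map_sum, map_zsmul,
      LinearMap.coe_sum, Finset.sum_apply, LinearMap.smul_apply, root_coroot_eq_pairing,
      map_mul, algebraMap_pairingIn, zsmul_eq_mul, eq_intCast]

/-- A root that pairs nonnegatively with the simple roots pairs nonnegatively with all the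
positive roots. -/
lemma pairingIn_nonneg_of_isPos (b : P.Base) {i : ι}
    (hi : ∀ j ∈ b.support, 0 ≤ P.pairingIn ℤ j i) {j : ι} (hj : b.IsPos j) :
    0 ≤ P.pairingIn ℤ j i := by
  obtain ⟨f, hf⟩ := b.exists_nat_of_mem_closure (b.root_mem_closure_of_isPos hj)
  rw [pairingIn_eq_sum_mul (f := fun k ↦ (f k : ℤ)) (s := b.support) (by simpa using hf)]
  exact Finset.sum_nonneg fun k hk ↦ mul_nonneg (by positivity) (hi k hk)

section

variable [Fintype ι]

lemma absPairingSum_reflectionPerm (k i : ι) :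
    absPairingSum P (P.reflectionPerm k i) = absPairingSum P i :=
  absPairingSum_comp_equiv _ (fun i j ↦ by
    rw [pairingIn_reflectionPerm, reflectionPerm_self]) i

lemma pairingIn_nonneg_comm {i j : ι} : 0 ≤ P.pairingIn ℤ i j ↔ 0 ≤ P.pairingIn ℤ j i := by
  rw [← not_lt, ← not_lt, P.pairingIn_lt_zero_iff]

end

/-- Were the pairing negative, the reflection in the simple root would add a positive multiple of
that root. -/
lemma IsMaximal.pairingIn_nonneg {b : P.Base} {i : ι} (hi : b.IsMaximal i) {j : ι}
    (hj : j ∈ b.support) : 0 ≤ P.pairingIn ℤ i j := by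
  by_contra! h
  have h1 : P.root (P.reflectionPerm j i) - P.root i = (-P.pairingIn ℤ i j) • P.root j := by
    rw [root_reflectionPerm, neg_smul, reflection_apply_root' ℤ]
    abel
  have h2 : P.reflectionPerm j i = i := by
    refine hi _ ?_
    rw [h1, ← Int.toNat_of_nonneg (a := -P.pairingIn ℤ i j) (by omega), natCast_zsmul]
    exact nsmul_mem (AddSubmonoid.subset_closure (mem_image_of_mem _ hj)) _
  have h3 := b.height_add_zsmul (i := i) (j := j) (k := P.reflectionPerm j i)
    (z := -P.pairingIn ℤ i j) (by rw [← h1]; abel)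
  rw [h2, height_one_of_mem_support hj, smul_eq_mul, mul_one] at h3
  omega

variable [Fintype ι] [IsDomain R]

/-- A positive pairing of distinct roots makes their difference a root, hence positive or negative;
maximality decides the sign. -/
lemma IsMaximal.height_le {b : P.Base} {i : ι} (hi : b.IsMaximal i) {j : ι}
    (hj : 0 < P.pairingIn ℤ j i) : b.height j ≤ b.height i := by
  rcases eq_or_ne j i with rfl | hne
  · rfl
  obtain ⟨k, hk⟩ := P.root_sub_root_mem_of_pairingIn_pos hj hne
  rcases b.root_mem_or_neg_mem k with h | h
  · rw [hk] at h
    exact absurd (hi j h) hne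
  · rw [hk, neg_sub] at h
    exact (b.height_le_of_sub_mem_closure h).1

variable [P.IsReduced]

open scoped Classical in
/-- The sum of the positive coroots takes the value `2` on each simple root. -/
lemma sum_isPos_pairingIn_eq_two (b : P.Base) {i : ι} (hi : i ∈ b.support) :
    ∑ j with b.IsPos j, P.pairingIn ℤ i j = 2 := by
  have hmem : i ∈ Finset.univ.filter (fun j ↦ b.IsPos j) := by
    simpa using isPos_of_mem_support hi
  rw [← Finset.add_sum_erase _ _ hmem, pairingIn_same]
  -- The simple reflection permutes the other positive roots and negates their pairing with `i`, so
  -- the terms cancel in pairs.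
  suffices ∑ j ∈ (Finset.univ.filter (fun j ↦ b.IsPos j)).erase i, P.pairingIn ℤ i j = 0 by
    rw [this, add_zero]
  have key (j : ι) : P.pairingIn ℤ i (P.reflectionPerm i j) = - P.pairingIn ℤ i j := by
    rw [pairingIn_reflectionPerm, pairingIn_reflectionPerm_self_left]
  refine Finset.sum_involution (fun j _ ↦ P.reflectionPerm i j) ?_ ?_ ?_ ?_
  · intro j _
    rw [key, add_neg_cancel]
  · intro j _ hj h
    have := key j
    rw [h] at this
    omega
  · intro j hj
    simp only [Finset.mem_erase, Finset.mem_filter, Finset.mem_univ, true_and] at hj ⊢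
    refine ⟨fun h ↦ ?_, hj.2.reflectionPerm hi hj.1⟩
    have hj' : j = P.reflectionPerm i i := by
      conv_rhs => rw [← congrArg (P.reflectionPerm i) h]
      exact (reflectionPerm_self P i j).symm
    have h1 : b.height j = - b.height i := hj' ▸ b.height_reflectionPerm_self i
    have h2 := (isPos_iff _).mp hj.2
    rw [h1, height_one_of_mem_support hi] at h2
    omega
  · intro j _
    simp

-- Both sides are additive in the root, so the case of simple roots suffices: the sum of the
-- positive coroots is 2ρ^∨.
open scoped Classical in
lemma sum_isPos_pairingIn (b : P.Base) (i : ι) :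
    ∑ j with b.IsPos j, P.pairingIn ℤ i j = 2 * b.height i := by
  obtain ⟨f, -, -, hf⟩ := b.exists_root_eq_sum_int i
  simp_rw [pairingIn_eq_sum_mul hf]
  rw [Finset.sum_comm, height_eq_sum hf, Finset.mul_sum]
  refine Finset.sum_congr rfl fun j hj ↦ ?_
  rw [← Finset.mul_sum, sum_isPos_pairingIn_eq_two b hj, mul_comm]

/-- For dominant `i` the absolute values can be dropped on positive roots, which gives 2 ht;
negation shows that the negative roots contribute as much. -/
lemma absPairingSum_eq_of_pairingIn_nonneg (b : P.Base) {i : ι}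
    (hi : ∀ j ∈ b.support, 0 ≤ P.pairingIn ℤ i j) :
    absPairingSum P i = 4 * b.height i := by
  classical
  have hpos {j : ι} (hj : b.IsPos j) : 0 ≤ P.pairingIn ℤ i j :=
    pairingIn_nonneg_comm.mp
      (b.pairingIn_nonneg_of_isPos (fun k hk ↦ pairingIn_nonneg_comm.mp (hi k hk)) hj)
  let := P.indexNeg
  have h1 : ∑ j with b.IsPos j, |P.pairingIn ℤ i j| = 2 * b.height i := by
    rw [← b.sum_isPos_pairingIn]
    refine Finset.sum_congr rfl fun j hj ↦ abs_of_nonneg (hpos (by simpa using hj))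
  have h2 : ∑ j with ¬ b.IsPos j, |P.pairingIn ℤ i j| =
      ∑ j with b.IsPos j, |P.pairingIn ℤ i j| := by
    refine Finset.sum_nbij' (fun j ↦ -j) (fun j ↦ -j) ?_ ?_ ?_ ?_ ?_
    · intro j hj
      simp only [Finset.mem_filter, Finset.mem_univ, true_and] at hj ⊢
      rwa [IsPos.neg_iff_not]
    · intro j hj
      simp only [Finset.mem_filter, Finset.mem_univ, true_and] at hj ⊢
      rwa [IsPos.neg_iff_not, not_not]
    · exact fun j _ ↦ neg_neg j
    · exact fun j _ ↦ neg_neg j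
    · intro j _
      simp
  rw [absPairingSum, ← Finset.sum_filter_add_sum_filter_not _ (fun j ↦ b.IsPos j), h2, h1]
  ring

lemma IsMaximal.absPairingSum_eq {b : P.Base} {i : ι} (hi : b.IsMaximal i) :
    absPairingSum P i = 4 * b.height i :=
  b.absPairingSum_eq_of_pairingIn_nonneg fun _ hj ↦ hi.pairingIn_nonneg hj

/-- Among the roots with the same invariant as `j` and positive pairing with `i`, one of greatest
height is dominant: a simple reflection that raised it would keep both properties. Its invariant is
then four times its height, which is at most that of `i`. -/
lemma IsMaximal.absPairingSum_le_of_pos {b : P.Base} {i : ι} (hi : b.IsMaximal i) {j : ι}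
    (hj : 0 < P.pairingIn ℤ j i) : absPairingSum P j ≤ absPairingSum P i := by
  classical
  obtain ⟨k, hk, hmax⟩ := Finset.exists_max_image
    (Finset.univ.filter fun k ↦ 0 < P.pairingIn ℤ k i ∧ absPairingSum P k = absPairingSum P j)
    b.height ⟨j, by simpa using hj⟩
  simp only [Finset.mem_filter, Finset.mem_univ, true_and, and_imp] at hk hmax
  rw [← hk.2, hi.absPairingSum_eq, b.absPairingSum_eq_of_pairingIn_nonneg]
  · linarith [hi.height_le hk.1]
  intro l hl
  by_contra! hlt
  have h1 : P.root (P.reflectionPerm l k) = P.root k + (-P.pairingIn ℤ k l) • P.root l := by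
    rw [root_reflectionPerm, neg_smul, reflection_apply_root' ℤ]
    abel
  have h2 := b.height_add_zsmul h1
  rw [height_one_of_mem_support hl, smul_eq_mul, mul_one] at h2
  have h3 := hmax (P.reflectionPerm l k) ?_ (by rw [absPairingSum_reflectionPerm, hk.2])
  · omega
  · have h4 : P.pairingIn ℤ (P.reflectionPerm l k) i =
        P.pairingIn ℤ k i + (-P.pairingIn ℤ k l) * P.pairingIn ℤ l i := by
      have := pairingIn_eq_add_of_root_eq_smul_add_smul (P := P) (S := ℤ) (i := k) (j := i) (l := l)
        (k := P.reflectionPerm l k) (x := 1) (y := -P.pairingIn ℤ k l) (by rw [h1, one_smul])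
      simpa using this
    have h5 := pairingIn_nonneg_comm.mp (hi.pairingIn_nonneg hl)
    have h6 := mul_nonneg (a := -P.pairingIn ℤ k l) (by omega) h5
    omega

lemma IsMaximal.absPairingSum_le {b : P.Base} {i : ι} (hi : b.IsMaximal i) {j : ι}
    (hj : P.pairingIn ℤ j i ≠ 0) : absPairingSum P j ≤ absPairingSum P i := by
  rcases hj.lt_or_gt with h | h
  · rw [← absPairingSum_reflectionPerm j j]
    refine hi.absPairingSum_le_of_pos ?_
    rw [pairingIn_reflectionPerm_self_left]
    omega
  · exact hi.absPairingSum_le_of_pos h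

/-- Given a permutation `e` of the roots that preserves the Cartan integers and a maximal root `i`,
if no root is orthogonal to all the roots that are obtained from `i` by reflections and by `e`,
then `i` has the largest height among the roots. -/
lemma IsMaximal.height_le_of_reflTransGen {b : P.Base} {i : ι} (hi : b.IsMaximal i) (e : ι ≃ ι)
    (he : ∀ i j, P.pairingIn ℤ (e i) (e j) = P.pairingIn ℤ i j)
    (hirr : ∀ j, ∃ k, Relation.ReflTransGen
      (fun k l ↦ l = e k ∨ ∃ m, l = P.reflectionPerm m k) i k ∧ P.pairingIn ℤ j k ≠ 0) (j : ι) :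
    b.height j ≤ b.height i := by
  -- The bound at `i` moves along the chain because reflections and `e` preserve both the pairings
  -- and the invariant.
  have key (k : ι) (hk : Relation.ReflTransGen
      (fun k l ↦ l = e k ∨ ∃ m, l = P.reflectionPerm m k) i k) :
      ∀ j, P.pairingIn ℤ j k ≠ 0 → absPairingSum P j ≤ absPairingSum P i := by
    induction hk with
    | refl => exact fun j hj ↦ hi.absPairingSum_le hj
    | @tail k l _ hkl ih =>
      intro j hj
      rcases hkl with rfl | ⟨m, rfl⟩
      · rw [← e.apply_symm_apply j, absPairingSum_comp_equiv e he]
        refine ih _ ?_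
        rwa [← he, e.apply_symm_apply]
      · rw [← absPairingSum_reflectionPerm m]
        refine ih _ ?_
        rwa [← pairingIn_reflectionPerm]
  have : Nonempty ι := ⟨j⟩
  obtain ⟨m, hm⟩ := Finite.exists_max b.height
  -- A root of greatest height is maximal, so its invariant is also four times its height and can be
  -- compared with that of `i`.
  have hmmax : b.IsMaximal m := fun l hl ↦ by
    obtain ⟨h1, h2⟩ := b.height_le_of_sub_mem_closure hl
    exact (h2 (le_antisymm h1 (hm l))).symm
  obtain ⟨k, hk, hk'⟩ := hirr m
  have h1 := key k hk m hk'
  rw [hmmax.absPairingSum_eq, hi.absPairingSum_eq] at h1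
  have h2 := hm j
  omega

end RootPairing.Base

namespace CoxeterReal

/-! ### Involutive automorphisms that preserve a Cartan subalgebra. -/

section Automorphism

variable {K L : Type*} [Field K] [LieRing L] [LieAlgebra K L] {H : LieSubalgebra K L}
  {T : L ≃ₗ⁅K⁆ L} {u : H →ₗ[K] H}

lemma involutive_of_coe_eq (hTT : ∀ x, T (T x) = x) (hu : ∀ h : H, (u h : L) = T h) (h : H) :
    u (u h) = h :=
  Subtype.ext (by rw [hu, hu, hTT])

lemma traceForm_map (hu : ∀ h : H, (u h : L) = T h) (x y : H) :
    LieModule.traceForm K H L (u x) (u y) = LieModule.traceForm K H L x y := by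
  have h1 (x y : H) : LieModule.traceForm K H L x y = killingForm K L x y := rfl
  rw [h1, h1, hu, hu, killingForm_of_equiv_apply]

/-- The coroot is built from the root through the Killing form, which the automorphism preserves;
`u` is its own inverse. -/
lemma coroot_eq_map_coroot [FiniteDimensional K L] [H.IsCartanSubalgebra] [CharZero K]
    [IsKilling K L] (hTT : ∀ x, T (T x) = x) (hu : ∀ h : H, (u h : L) = T h)
    {i j : H.root} (hij : ∀ h, j.1 h = i.1 (u h)) : coroot j.1 = u (coroot i.1) := by
  have huu := involutive_of_coe_eq hTT hu
  have h1 : (cartanEquivDual H).symm j.1 = u ((cartanEquivDual H).symm i.1) := by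
    rw [LinearEquiv.symm_apply_eq]
    ext h
    have h2 := traceForm_map hu ((cartanEquivDual H).symm i.1) (u h)
    rw [huu] at h2
    have h3 := LinearMap.congr_fun ((cartanEquivDual H).apply_symm_apply i.1.toLinear) (u h)
    exact (hij h).trans (h3.symm.trans h2.symm)
  rw [coroot, coroot, h1, hij, huu, map_nsmul, map_smul]

variable [FiniteDimensional K L] [H.IsCartanSubalgebra] [LieModule.IsTriangularizable K H L]

/-- An additive property that holds for the weight vectors holds everywhere. -/
lemma weight_induction {p : L → Prop} (hmem : ∀ (χ : LieModule.Weight K H L) (x : L),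
    x ∈ rootSpace H χ → p x) (hzero : p 0) (hadd : ∀ x y, p x → p y → p (x + y)) (x : L) : p x := by
  have hx : x ∈ ⨆ χ : LieModule.Weight K H L, LieModule.genWeightSpace L χ := by
    simp [LieModule.iSup_genWeightSpace_eq_top' K H L]
  induction hx using LieSubmodule.iSup_induction' with
  | mem χ x hx => exact hmem χ x hx
  | zero => exact hzero
  | add x y _ _ hx hy => exact hadd x y hx hy

variable [CharZero K] [IsKilling K L]

lemma mem_rootSpace_iff {χ : H → K} {x : L} :
    x ∈ rootSpace H χ ↔ ∀ h : H, ⁅(h : L), x⁆ = χ h • x := by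
  refine ⟨fun hx h ↦ lie_eq_smul_of_mem_rootSpace hx h, fun hx ↦ ?_⟩
  exact LieModule.weightSpace_le_genWeightSpace L χ ((LieModule.mem_weightSpace χ x).mpr hx)

lemma map_mem_rootSpace (hTT : ∀ x, T (T x) = x) (hu : ∀ h : H, (u h : L) = T h) {χ : H → K}
    {x : L} (hx : x ∈ rootSpace H χ) : T x ∈ rootSpace H (χ ∘ u) := by
  rw [mem_rootSpace_iff] at hx ⊢
  intro h
  have := congrArg T (hx (u h))
  rwa [hu, LieEquiv.map_lie, hTT, map_smul] at this

lemma exists_weight_comp (hTT : ∀ x, T (T x) = x) (hu : ∀ h : H, (u h : L) = T h)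
    (χ : LieModule.Weight K H L) : ∃ ψ : LieModule.Weight K H L, (ψ : H → K) = χ ∘ u := by
  refine ⟨⟨χ ∘ u, fun h ↦ ?_⟩, rfl⟩
  obtain ⟨x, hx, hx0⟩ := χ.exists_ne_zero
  have hTx := map_mem_rootSpace hTT hu hx
  rw [rootSpace, h, LieSubmodule.mem_bot] at hTx
  exact hx0 (by rw [← hTT x, hTx, map_zero])

/-- An involutive automorphism that preserves a Cartan subalgebra permutes the roots. -/
lemma exists_root_equiv (hTT : ∀ x, T (T x) = x) (hu : ∀ h : H, (u h : L) = T h) :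
    ∃ e : H.root ≃ H.root, (∀ i h, (e i).1 h = i.1 (u h)) ∧ ∀ i, e (e i) = i := by
  have huu := involutive_of_coe_eq hTT hu
  have key (i : H.root) : ∃ j : H.root, ∀ h, j.1 h = i.1 (u h) := by
    obtain ⟨ψ, hψ⟩ := exists_weight_comp hTT hu i.1
    refine ⟨⟨ψ, ?_⟩, congrFun hψ⟩
    simp only [LieSubalgebra.root, Finset.mem_filter, Finset.mem_univ, true_and]
    intro h0
    refine LieSubalgebra.isNonZero_coe_root i (funext fun h ↦ ?_)
    have := congrFun hψ (u h)
    rw [h0] at this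
    simpa [huu] using this.symm
  choose e he using key
  have hee (i : H.root) : e (e i) = i := by
    apply Subtype.ext
    ext h
    rw [he, he, huu]
  exact ⟨⟨e, e, hee, hee⟩, he, hee⟩

lemma pairing_root_equiv (hTT : ∀ x, T (T x) = x) (hu : ∀ h : H, (u h : L) = T h)
    {e : H.root ≃ H.root} (he : ∀ i h, (e i).1 h = i.1 (u h)) (i j : H.root) :
    (rootSystem H).pairing (e i) (e j) = (rootSystem H).pairing i j := by
  rw [rootSystem_pairing_apply, rootSystem_pairing_apply, coroot_eq_map_coroot hTT hu (he j), he,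
    involutive_of_coe_eq hTT hu]

end Automorphism

/-! ### Exponentials on eigenvectors. -/

section Exponential

lemma exp_mulVec_of_mulVec_eq_smul {n : Type*} [Fintype n] [DecidableEq n] {A : Matrix n n ℂ}
    {v : n → ℂ} {c : ℂ} (h : A.mulVec v = c • v) :
    (NormedSpace.exp A).mulVec v = Complex.exp c • v := by
  -- The norm only supplies convergence of the exponential series, to which the continuous map A ↦
  -- Av is then applied.
  let _ : NormedRing (Matrix n n ℂ) := Matrix.linftyOpNormedRing
  let _ : NormedAlgebra ℂ (Matrix n n ℂ) := Matrix.linftyOpNormedAlgebra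
  have h1 := NormedSpace.exp_series_hasSum_exp' (𝕂 := ℂ) A
  have h2 := NormedSpace.exp_series_hasSum_exp' (𝕂 := ℂ) c
  have hpow (k : ℕ) : (A ^ k).mulVec v = c ^ k • v := by
    induction k with
    | zero => simp
    | succ k ih => rw [pow_succ, ← Matrix.mulVec_mulVec, h, Matrix.mulVec_smul, ih, smul_smul,
        pow_succ, mul_comm]
  let φ : Matrix n n ℂ →ₗ[ℂ] (n → ℂ) := (Matrix.mulVecBilin ℂ ℂ).flip v
  have hφ : Continuous φ := LinearMap.continuous_of_finiteDimensional φ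
  have h3 := h1.map φ hφ
  have h4 := h2.smul_const v
  rw [← Complex.exp_eq_exp_ℂ] at h4
  refine h3.unique ?_
  convert h4 using 2 with k
  change ((k.factorial : ℂ)⁻¹ • A ^ k).mulVec v = _
  rw [Matrix.smul_mulVec, hpow, smul_assoc]

variable {V : Type*} [AddCommGroup V] [Module ℂ V] [FiniteDimensional ℂ V]

lemma endExp_apply_of_apply_eq_smul {f : Module.End ℂ V} {x : V} {c : ℂ} (h : f x = c • x) :
    endExp f x = Complex.exp c • x := by
  apply (Module.finBasis ℂ V).repr.injective
  apply DFunLike.coe_injective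
  rw [endExp, Matrix.repr_toLin, exp_mulVec_of_mulVec_eq_smul (c := c), map_smul,
    Finsupp.coe_smul]
  rw [LinearMap.toMatrix_mulVec_repr, h, map_smul, Finsupp.coe_smul]

lemma endExp_injective (f : Module.End ℂ V) : Function.Injective (endExp f) := by
  have h : IsUnit (endExp f) :=
    (Matrix.isUnit_exp _).map (Matrix.toLinAlgEquiv (Module.finBasis ℂ V))
  exact ((Module.End.isUnit_iff _).mp h).injective

end Exponential

/-! ### The conjugation with respect to the real form, and the Hermitian form given by Θ. -/

section Conjugation

variable {𝔤 : Type*} [LieRing 𝔤] [LieAlgebra ℝ 𝔤]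

variable (𝔤) in
/-- The conjugation of the complexification with respect to the real form. -/
def conj : ℂ ⊗[ℝ] 𝔤 →ₗ[ℝ] ℂ ⊗[ℝ] 𝔤 :=
  Complex.conjAe.toLinearMap.rTensor 𝔤

@[simp]
lemma conj_tmul (c : ℂ) (a : 𝔤) : conj 𝔤 (c ⊗ₜ[ℝ] a) = (starRingEnd ℂ c) ⊗ₜ[ℝ] a := rfl

@[simp]
lemma extend_tmul (Θ : 𝔤 →ₗ⁅ℝ⁆ 𝔤) (c : ℂ) (a : 𝔤) :
    extend Θ (c ⊗ₜ[ℝ] a) = c ⊗ₜ[ℝ] Θ a := rfl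

lemma conj_smul (c : ℂ) (x : ℂ ⊗[ℝ] 𝔤) : conj 𝔤 (c • x) = (starRingEnd ℂ c) • conj 𝔤 x := by
  induction x using TensorProduct.induction_on with
  | zero => simp
  | tmul d a => simp [TensorProduct.smul_tmul']
  | add x y hx hy => rw [smul_add, map_add, hx, hy, map_add, smul_add]

lemma conj_conj (x : ℂ ⊗[ℝ] 𝔤) : conj 𝔤 (conj 𝔤 x) = x := by
  induction x using TensorProduct.induction_on with
  | zero => simp
  | tmul d a => simp
  | add x y hx hy => rw [map_add, map_add, hx, hy]

lemma conj_lie (x y : ℂ ⊗[ℝ] 𝔤) : conj 𝔤 ⁅x, y⁆ = ⁅conj 𝔤 x, conj 𝔤 y⁆ := by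
  induction x using TensorProduct.induction_on with
  | zero => simp
  | add x x' hx hx' => rw [add_lie, map_add, hx, hx', map_add, add_lie]
  | tmul c a =>
    induction y using TensorProduct.induction_on with
    | zero =>
      rw [map_zero]
      exact (congrArg _ (lie_zero (c ⊗ₜ[ℝ] a))).trans
        ((map_zero _).trans (lie_zero (conj 𝔤 (c ⊗ₜ[ℝ] a))).symm)
    | add y y' hy hy' => rw [LieRing.lie_add, map_add, hy, hy', map_add, LieRing.lie_add]
    | tmul d b => simp

lemma extend_lie (Θ : 𝔤 →ₗ⁅ℝ⁆ 𝔤) (x y : ℂ ⊗[ℝ] 𝔤) :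
    extend Θ ⁅x, y⁆ = ⁅extend Θ x, extend Θ y⁆ := by
  induction x using TensorProduct.induction_on with
  | zero => simp
  | add x x' hx hx' => rw [add_lie, map_add, hx, hx', map_add, add_lie]
  | tmul c a =>
    induction y using TensorProduct.induction_on with
    | zero =>
      rw [map_zero]
      exact (congrArg _ (lie_zero (c ⊗ₜ[ℝ] a))).trans
        ((map_zero _).trans (lie_zero (extend Θ (c ⊗ₜ[ℝ] a))).symm)
    | add y y' hy hy' => rw [LieRing.lie_add, map_add, hy, hy', map_add, LieRing.lie_add]
    | tmul d b => simp

lemma conj_extend (Θ : 𝔤 →ₗ⁅ℝ⁆ 𝔤) (x : ℂ ⊗[ℝ] 𝔤) :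
    conj 𝔤 (extend Θ x) = extend Θ (conj 𝔤 x) := by
  induction x using TensorProduct.induction_on with
  | zero => simp
  | tmul d a => simp
  | add x y hx hy => rw [map_add, map_add, hx, hy, map_add, map_add]

lemma IsCartanInvolution.extend_extend {Θ : 𝔤 →ₗ⁅ℝ⁆ 𝔤} (hΘ : IsCartanInvolution Θ)
    (x : ℂ ⊗[ℝ] 𝔤) : extend Θ (extend Θ x) = x := by
  induction x using TensorProduct.induction_on with
  | zero => simp
  | tmul d a => simp [hΘ.involutive]
  | add x y hx hy => rw [map_add, map_add, hx, hy]

/-- The complex-linear extension of a Cartan involution, as an automorphism. -/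
def IsCartanInvolution.extendEquiv {Θ : 𝔤 →ₗ⁅ℝ⁆ 𝔤} (hΘ : IsCartanInvolution Θ) :
    (ℂ ⊗[ℝ] 𝔤) ≃ₗ⁅ℂ⁆ (ℂ ⊗[ℝ] 𝔤) :=
  { extend Θ with
    map_lie' := extend_lie Θ _ _
    invFun := extend Θ
    left_inv := hΘ.extend_extend
    right_inv := hΘ.extend_extend }

lemma mem_realForm_iff (x : ℂ ⊗[ℝ] 𝔤) : x ∈ realForm 𝔤 ↔ conj 𝔤 x = x := by
  constructor
  · rintro ⟨a, rfl⟩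
    simp
  · intro hx
    obtain ⟨a, b, rfl⟩ := exists_eq_add x
    refine ⟨a, ?_⟩
    have h : (2 : ℂ) • (Complex.I ⊗ₜ[ℝ] b : ℂ ⊗[ℝ] 𝔤) = 0 := by
      rw [map_add, conj_tmul, conj_tmul, map_one, Complex.conj_I, TensorProduct.neg_tmul,
        add_right_inj, neg_eq_iff_add_eq_zero, ← two_smul ℂ] at hx
      exact hx
    rw [(smul_eq_zero.mp h).resolve_left two_ne_zero, add_zero]
    rfl

lemma conj_mem_complexify (𝔱 : LieSubalgebra ℝ 𝔤) {x : ℂ ⊗[ℝ] 𝔤} (hx : x ∈ complexify 𝔱) :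
    conj 𝔤 x ∈ complexify 𝔱 := by
  obtain ⟨a, b, rfl⟩ := exists_eq_add x
  obtain ⟨ha, hb⟩ := mem_of_add_mem_complexify 𝔱 hx
  rw [map_add]
  exact add_mem (Submodule.tmul_mem_baseChange_of_mem _ ha)
    (Submodule.tmul_mem_baseChange_of_mem _ hb)

variable [FiniteDimensional ℝ 𝔤] {Θ : 𝔤 →ₗ⁅ℝ⁆ 𝔤}

lemma map_realForm_eq_iff (f : Module.End ℂ (ℂ ⊗[ℝ] 𝔤)) (hf : Function.Injective f) :
    (realForm 𝔤).map (f.restrictScalars ℝ) = realForm 𝔤 ↔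
      ∀ x, f (conj 𝔤 x) = conj 𝔤 (f x) := by
  constructor
  · intro h x
    have hreal (a : 𝔤) : conj 𝔤 (f (1 ⊗ₜ[ℝ] a)) = f (1 ⊗ₜ[ℝ] a) := by
      rw [← mem_realForm_iff, ← h]
      exact ⟨1 ⊗ₜ[ℝ] a, ⟨a, rfl⟩, rfl⟩
    induction x using TensorProduct.induction_on with
    | zero => simp
    | tmul c a =>
      have hc (c : ℂ) : (c ⊗ₜ[ℝ] a : ℂ ⊗[ℝ] 𝔤) = c • ((1 : ℂ) ⊗ₜ[ℝ] a) := by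
        rw [TensorProduct.smul_tmul', smul_eq_mul, mul_one]
      rw [conj_tmul, hc, hc c, map_smul, map_smul, conj_smul, hreal]
    | add x y hx hy => simp only [map_add, hx, hy]
  · intro h
    have hle : (realForm 𝔤).map (f.restrictScalars ℝ) ≤ realForm 𝔤 := by
      rintro _ ⟨x, hx, rfl⟩
      rw [mem_realForm_iff]
      change conj 𝔤 (f x) = f x
      rw [← h, (mem_realForm_iff x).mp hx]
    have : FiniteDimensional ℝ (realForm 𝔤) := by
      unfold realForm
      infer_instance
    exact Submodule.eq_of_le_of_finrank_eq hle
      (Submodule.equivMapOfInjective (f.restrictScalars ℝ) hf (realForm 𝔤)).finrank_eq.symm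

/-- For x = a + ib the real part is ⟨a, Θa⟩ + ⟨b, Θb⟩, which is negative unless a = b = 0. -/
lemma IsCartanInvolution.killingForm_ne_zero (hΘ : IsCartanInvolution Θ) {x : ℂ ⊗[ℝ] 𝔤}
    (hx : x ≠ 0) : killingForm ℂ (ℂ ⊗[ℝ] 𝔤) x (extend Θ (conj 𝔤 x)) ≠ 0 := by
  obtain ⟨a, b, rfl⟩ := exists_eq_add x
  have hnn (c : 𝔤) : killingForm ℝ 𝔤 c (Θ c) ≤ 0 := by
    rcases eq_or_ne c 0 with rfl | hc
    · simp
    · linarith [hΘ.posDef c hc]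
  intro h
  have h' : LieModule.traceForm ℂ (ℂ ⊗[ℝ] 𝔤) (ℂ ⊗[ℝ] 𝔤) (1 ⊗ₜ[ℝ] a + Complex.I ⊗ₜ[ℝ] b)
    (extend Θ (conj 𝔤 (1 ⊗ₜ[ℝ] a + Complex.I ⊗ₜ[ℝ] b))) = 0 := h
  rw [LieModule.traceForm_baseChange] at h'
  have hre := congrArg Complex.re h'
  simp [TensorProduct.neg_tmul] at hre
  have ha : a = 0 := by
    by_contra ha
    linarith [hΘ.posDef a ha, hnn b]
  have hb : b = 0 := by
    by_contra hb
    linarith [hΘ.posDef b hb, hnn a]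
  exact hx (by simp [ha, hb])

/-- With respect to the positive definite Hermitian form `-⟨X, Θ conj Y⟩`, the adjoint of `ad h`
is `-ad (Θ conj h)`, so the eigenvalues of these on a common eigenvector are related by
conjugation. -/
lemma IsCartanInvolution.eigenvalue_eq (hΘ : IsCartanInvolution Θ) {h x : ℂ ⊗[ℝ] 𝔤} {c d : ℂ}
    (hx : x ≠ 0) (hc : ⁅h, x⁆ = c • x) (hd : ⁅extend Θ (conj 𝔤 h), x⁆ = d • x) :
    c = -starRingEnd ℂ d := by
  have h1 : ⁅h, extend Θ (conj 𝔤 x)⁆ = starRingEnd ℂ d • extend Θ (conj 𝔤 x) := by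
    rw [← map_smul, ← conj_smul, ← hd, conj_lie, extend_lie, conj_extend, conj_conj,
      hΘ.extend_extend]
  have h2 := LieModule.traceForm_apply_lie_apply' ℂ (ℂ ⊗[ℝ] 𝔤) (ℂ ⊗[ℝ] 𝔤) h x
    (extend Θ (conj 𝔤 x))
  rw [h1, hc, map_smul, map_smul, LinearMap.smul_apply, smul_eq_mul, smul_eq_mul,
    ← neg_mul] at h2
  exact mul_right_cancel₀ (hΘ.killingForm_ne_zero hx) h2

end Conjugation

/-! ### Eigenvalues of the Coxeter automorphism in terms of heights. -/

section Coxeter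

variable {L : Type*} [LieRing L] [LieAlgebra ℂ L] [FiniteDimensional ℂ L]
  [LieAlgebra.IsKilling ℂ L] {H : LieSubalgebra ℂ L} [H.IsCartanSubalgebra]

lemma root_apply_sum_dualVector (b : (rootSystem H).Base) (i : H.root) :
    i.1 (∑ j, dualVector b j) = (b.height i : ℂ) := by
  obtain ⟨f, -, -, hf⟩ := b.exists_root_eq_sum_int i
  have h1 (j : b.support) (φ : Module.Dual ℂ H) :
      φ (dualVector b j) = b.toWeightBasis.coord j φ :=
    LinearMap.congr_fun ((Module.evalEquiv ℂ H).apply_symm_apply (b.toWeightBasis.coord j)) φ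
  have h2 : (rootSystem H).root i = ∑ j : b.support, (f j : ℂ) • b.toWeightBasis j := by
    rw [hf, ← Finset.sum_coe_sort]
    simp [Int.cast_smul_eq_zsmul]
  change (rootSystem H).root i (∑ j, dualVector b j) = _
  rw [map_sum, RootPairing.Base.height_eq_sum hf, Int.cast_sum, ← Finset.sum_coe_sort b.support]
  refine Finset.sum_congr rfl fun j _ ↦ ?_
  rw [h1, h2, Module.Basis.coord_apply, Module.Basis.repr_sum_self]

/-- The element `(2πi/k) ∑ⱼ ηⱼ` of the Cartan subalgebra that defines the Coxeter automorphism. -/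
def coxeterElement (b : (rootSystem H).Base) : H :=
  (2 * Real.pi * Complex.I / (coxeterNumber b : ℂ)) • ∑ j, dualVector b j

lemma coxeterAut_apply_of_mem_rootSpace (b : (rootSystem H).Base) {χ : H → ℂ} {x : L}
    (hx : x ∈ rootSpace H χ) : coxeterAut b x = Complex.exp (χ (coxeterElement b)) • x :=
  endExp_apply_of_apply_eq_smul (mem_rootSpace_iff.mp hx (coxeterElement b))

lemma root_apply_coxeterElement (b : (rootSystem H).Base) (i : H.root) :
    i.1 (coxeterElement b) = 2 * Real.pi * Complex.I * (b.height i / (coxeterNumber b : ℂ)) := by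
  have h := map_smul ((rootSystem H).root i) (2 * Real.pi * Complex.I / (coxeterNumber b : ℂ))
    (∑ j, dualVector b j)
  have h' : i.1 (coxeterElement b) = (2 * Real.pi * Complex.I / (coxeterNumber b : ℂ)) *
      i.1 (∑ j, dualVector b j) := h
  rw [h', root_apply_sum_dualVector]
  ring

lemma height_lt_coxeterNumber (b : (rootSystem H).Base) (i : H.root) :
    b.height i < coxeterNumber b :=
  Int.lt_add_one_of_le (le_ciSup (Set.finite_range _).bddAbove i)

lemma neg_coxeterNumber_lt_height (b : (rootSystem H).Base) (i : H.root) :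
    -coxeterNumber b < b.height i := by
  have h := height_lt_coxeterNumber b ((rootSystem H).reflectionPerm i i)
  have h' : b.height ((rootSystem H).reflectionPerm i i) = - b.height i :=
    b.height_reflectionPerm_self i
  omega

lemma exists_height_eq [Nonempty H.root] (b : (rootSystem H).Base) :
    ∃ i, b.height i = coxeterNumber b - 1 := by
  obtain ⟨i, hi⟩ := exists_eq_ciSup_of_finite (f := b.height)
  exact ⟨i, by rw [coxeterNumber, hi]; ring⟩

lemma two_le_coxeterNumber [Nonempty H.root] (b : (rootSystem H).Base) : 2 ≤ coxeterNumber b := by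
  obtain ⟨i, hi⟩ := b.support_nonempty
  have h := height_lt_coxeterNumber b i
  rw [RootPairing.Base.height_one_of_mem_support hi] at h
  omega

lemma exp_root_apply_coxeterElement_eq_iff [Nonempty H.root] (b : (rootSystem H).Base)
    (i j : H.root) :
    Complex.exp (i.1 (coxeterElement b)) = Complex.exp (j.1 (coxeterElement b)) ↔
      coxeterNumber b ∣ b.height i - b.height j := by
  have hk : (coxeterNumber b : ℂ) ≠ 0 := by
    have := two_le_coxeterNumber b
    exact_mod_cast (by omega : coxeterNumber b ≠ 0)
  rw [Complex.exp_eq_exp_iff_exists_int, root_apply_coxeterElement, root_apply_coxeterElement]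
  refine exists_congr fun n ↦ ?_
  have h2 := Complex.two_pi_I_ne_zero
  constructor
  · intro h
    have h3 : 2 * Real.pi * Complex.I * ((b.height i : ℂ) / coxeterNumber b) =
      2 * Real.pi * Complex.I * (b.height j / coxeterNumber b + n) := by rw [h]; ring
    have h4 := mul_left_cancel₀ h2 h3
    field_simp at h4
    have h5 : b.height i = b.height j + coxeterNumber b * n := by exact_mod_cast h4
    omega
  · intro h
    have h5 : (b.height i : ℂ) = b.height j + coxeterNumber b * n := by
      exact_mod_cast (by omega : b.height i = b.height j + coxeterNumber b * n)
    rw [h5]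
    field_simp

end Coxeter

/-! ### Conjugation-stable ideals, and the action of Θ and of the conjugation on root spaces. -/

variable {𝔤 : Type*} [LieRing 𝔤] [LieAlgebra ℝ 𝔤]
  {𝔱 : LieSubalgebra ℝ 𝔤} {Θ : 𝔤 →ₗ⁅ℝ⁆ 𝔤}

/-- A Lie ideal of the complexification of a simple real Lie algebra that contains a nonzero element
together with its conjugate is the whole Lie algebra. -/
lemma eq_top_of_mem_of_conj_mem [LieAlgebra.IsSimple ℝ 𝔤] (I : LieIdeal ℂ (ℂ ⊗[ℝ] 𝔤))
    {x : ℂ ⊗[ℝ] 𝔤} (hx0 : x ≠ 0) (hx : x ∈ I) (hx' : conj 𝔤 x ∈ I) : I = ⊤ := by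
  -- `J` is the ideal of real points of `I`; it contains the real and imaginary parts of `x`, so
  -- simplicity of 𝔤 forces `J` to be everything.
  let J : LieIdeal ℝ 𝔤 :=
    { (I.toSubmodule.restrictScalars ℝ).comap (TensorProduct.mk ℝ ℂ 𝔤 1) with
      lie_mem := fun {y z} hz ↦ by
        change (1 : ℂ) ⊗ₜ[ℝ] ⁅y, z⁆ ∈ I
        have := lie_mem_right ℂ (ℂ ⊗[ℝ] 𝔤) I ((1 : ℂ) ⊗ₜ[ℝ] y) ((1 : ℂ) ⊗ₜ[ℝ] z) hz
        simpa using this }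
  have hJ (a : 𝔤) : a ∈ J ↔ (1 : ℂ) ⊗ₜ[ℝ] a ∈ I := Iff.rfl
  have hI (c : ℂ) (a : 𝔤) (ha : a ∈ J) : c ⊗ₜ[ℝ] a ∈ I := by
    rw [← mul_one c, ← smul_eq_mul, ← TensorProduct.smul_tmul']
    exact I.smul_mem c ha
  obtain ⟨a, b, rfl⟩ := exists_eq_add x
  have ha : a ∈ J := by
    have h : (2⁻¹ : ℂ) • ((1 ⊗ₜ[ℝ] a + Complex.I ⊗ₜ[ℝ] b) +
      conj 𝔤 (1 ⊗ₜ[ℝ] a + Complex.I ⊗ₜ[ℝ] b)) = (1 : ℂ) ⊗ₜ[ℝ] a := by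
      simp only [map_add, conj_tmul, map_one, Complex.conj_I, TensorProduct.neg_tmul]
      module
    rw [hJ, ← h]
    exact I.smul_mem _ (add_mem hx hx')
  have hb : b ∈ J := by
    have h : (-2⁻¹ * Complex.I : ℂ) • ((1 ⊗ₜ[ℝ] a + Complex.I ⊗ₜ[ℝ] b) -
      conj 𝔤 (1 ⊗ₜ[ℝ] a + Complex.I ⊗ₜ[ℝ] b)) = (1 : ℂ) ⊗ₜ[ℝ] b := by
      simp only [map_add, conj_tmul, map_one, Complex.conj_I, TensorProduct.neg_tmul]
      have : (Complex.I ⊗ₜ[ℝ] b : ℂ ⊗[ℝ] 𝔤) = Complex.I • ((1 : ℂ) ⊗ₜ[ℝ] b) := by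
        rw [TensorProduct.smul_tmul', smul_eq_mul, mul_one]
      rw [this]
      match_scalars
      · ring
      · ring_nf; simp
    rw [hJ, ← h]
    exact I.smul_mem _ (sub_mem hx hx')
  rcases LieAlgebra.IsSimple.eq_bot_or_eq_top J with h | h
  · rw [h, LieSubmodule.mem_bot] at ha hb
    simp [ha, hb] at hx0
  · rw [eq_top_iff]
    intro y _
    induction y using TensorProduct.induction_on with
    | zero => exact I.zero_mem
    | tmul c a => exact hI c a (h ▸ trivial)
    | add y z hy hz => exact add_mem (hy trivial) (hz trivial)

/-- The restriction of the complex-linear extension of `Θ` to the Cartan subalgebra. -/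
def cartanAction (hΘ𝔱 : ∀ x ∈ 𝔱, Θ x ∈ 𝔱) : complexify 𝔱 →ₗ[ℂ] complexify 𝔱 :=
  (extend Θ).restrict (extend_mem 𝔱 Θ hΘ𝔱)

lemma coe_cartanAction (hΘ : IsCartanInvolution Θ) (hΘ𝔱 : ∀ x ∈ 𝔱, Θ x ∈ 𝔱) (h : complexify 𝔱) :
    (cartanAction hΘ𝔱 h : ℂ ⊗[ℝ] 𝔤) = hΘ.extendEquiv h := rfl

variable [FiniteDimensional ℝ 𝔤] [LieAlgebra.IsKilling ℝ 𝔤] [𝔱.IsCartanSubalgebra]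

lemma extend_mem_rootSpace (hΘ : IsCartanInvolution Θ) (hΘ𝔱 : ∀ x ∈ 𝔱, Θ x ∈ 𝔱)
    {χ : complexify 𝔱 → ℂ} {x : ℂ ⊗[ℝ] 𝔤} (hx : x ∈ rootSpace (complexify 𝔱) χ) :
    extend Θ x ∈ rootSpace (complexify 𝔱) (χ ∘ cartanAction hΘ𝔱) :=
  map_mem_rootSpace hΘ.extend_extend (coe_cartanAction hΘ hΘ𝔱) hx

/-- The conjugation with respect to the real form acts on the roots by `-Θ`. -/
lemma conj_mem_rootSpace (hΘ : IsCartanInvolution Θ) (hΘ𝔱 : ∀ x ∈ 𝔱, Θ x ∈ 𝔱)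
    {χ : complexify 𝔱 → ℂ} {x : ℂ ⊗[ℝ] 𝔤} (hx : x ∈ rootSpace (complexify 𝔱) χ) :
    conj 𝔤 x ∈ rootSpace (complexify 𝔱) (-(χ ∘ cartanAction hΘ𝔱)) := by
  rcases eq_or_ne x 0 with rfl | hx0
  · simp
  rw [mem_rootSpace_iff] at hx ⊢
  intro h
  let h' : complexify 𝔱 := ⟨conj 𝔤 h, conj_mem_complexify 𝔱 h.2⟩
  have h1 := congrArg (conj 𝔤) (hx h')
  rw [conj_lie, conj_smul] at h1
  change ⁅conj 𝔤 (conj 𝔤 (h : ℂ ⊗[ℝ] 𝔤)), conj 𝔤 x⁆ = _ at h1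
  rw [conj_conj] at h1
  refine h1.trans ?_
  congr 1
  -- Since `h` is the conjugate of `h'`, the element paired with `h'` by the adjoint relation is Θh.
  have h2 : ⁅extend Θ (conj 𝔤 (h' : ℂ ⊗[ℝ] 𝔤)), x⁆ = χ (cartanAction hΘ𝔱 h) • x := by
    have := hx (cartanAction hΘ𝔱 h)
    change ⁅extend Θ (conj 𝔤 (conj 𝔤 (h : ℂ ⊗[ℝ] 𝔤))), x⁆ = _
    rw [conj_conj]
    exact this
  rw [hΘ.eigenvalue_eq hx0 (hx h') h2]
  simp

/-! ### Consequences of the simplicity of 𝔤 for the root system. -/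

section Simple

variable [LieAlgebra.IsSimple ℝ 𝔤]

/-- Without roots, the Cartan subalgebra would vanish, and with it the whole algebra. Existence of a
root is what gives k ≥ 2. -/
lemma nonempty_root : Nonempty (complexify 𝔱).root := by
  by_contra hcon
  rw [not_nonempty_iff] at hcon
  have hdual : Subsingleton (Module.Dual ℂ (complexify 𝔱)) := by
    rw [← Submodule.subsingleton_iff ℂ, ← subsingleton_iff_bot_eq_top,
      ← RootPairing.IsRootSystem.span_root_eq_top (P := rootSystem (complexify 𝔱)),
      Set.range_eq_empty, Submodule.span_empty]
  have hH : Subsingleton (complexify 𝔱) := (Module.subsingleton_dual_iff ℂ).mp hdual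
  have hL (x : ℂ ⊗[ℝ] 𝔤) : x = 0 := by
    refine weight_induction (H := complexify 𝔱) (p := fun x ↦ x = 0) (fun χ x hx ↦ ?_) rfl
      (fun x y hx hy ↦ by rw [hx, hy, add_zero]) x
    have hχ : (χ : complexify 𝔱 → ℂ) = 0 := funext fun h ↦ by
      rw [Subsingleton.elim h 0]
      exact map_zero χ.toLinear
    rw [hχ, rootSpace_zero_eq] at hx
    exact congrArg Subtype.val (Subsingleton.elim (⟨x, hx⟩ : complexify 𝔱) 0)
  have : Nontrivial 𝔤 := by
    by_contra h
    rw [not_nontrivial_iff_subsingleton] at h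
    exact LieAlgebra.IsSimple.non_abelian ℝ (L := 𝔤) inferInstance
  have h1 : 0 < Module.finrank ℂ (ℂ ⊗[ℝ] 𝔤) := by
    rw [Module.finrank_baseChange]
    exact Module.finrank_pos
  have := Module.nontrivial_of_finrank_pos h1
  obtain ⟨x, hx⟩ := exists_ne (0 : ℂ ⊗[ℝ] 𝔤)
  exact hx (hL x)

/-- A nonempty set of roots that is stable under the reflections and under `Θ` is not orthogonal to
any root. -/
lemma exists_pairing_ne_zero (hΘ : IsCartanInvolution Θ) (hΘ𝔱 : ∀ x ∈ 𝔱, Θ x ∈ 𝔱)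
    {e : (complexify 𝔱).root ≃ (complexify 𝔱).root}
    (he : ∀ i h, (e i).1 h = i.1 (cartanAction hΘ𝔱 h)) (hee : ∀ i, e (e i) = i)
    {S : Set (complexify 𝔱).root} {i₀ : (complexify 𝔱).root} (hi₀ : i₀ ∈ S)
    (hS : ∀ i ∈ S, ∀ k, (rootSystem (complexify 𝔱)).reflectionPerm k i ∈ S)
    (hSe : ∀ i ∈ S, e i ∈ S) (j : (complexify 𝔱).root) :
    ∃ k ∈ S, (rootSystem (complexify 𝔱)).pairing j k ≠ 0 := by
  by_contra! hcon
  set P := rootSystem (complexify 𝔱)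
  -- The orthogonal of `S` is stable under reflections, so it defines an ideal that contains the
  -- root spaces of the roots in it.
  let q : Submodule ℂ (Module.Dual ℂ (complexify 𝔱)) :=
    ⨅ k ∈ S, LinearMap.ker (P.coroot' k)
  have mem_q (x : Module.Dual ℂ (complexify 𝔱)) : x ∈ q ↔ ∀ k ∈ S, P.coroot' k x = 0 := by
    simp [q]
  have hq : ∀ i, q ∈ Module.End.invtSubmodule (P.reflection i).toLinearMap := by
    intro i x hx
    rw [mem_q] at hx
    rw [Submodule.mem_comap, mem_q]
    intro k hk
    have h1 := hx _ (hS k hk i)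
    rw [RootPairing.coroot', RootPairing.coroot_reflectionPerm] at h1
    rw [← h1]
    simp [RootPairing.reflection_apply, RootPairing.coreflection_apply, mul_comm]
  let I := invtSubmoduleToLieIdeal q hq
  have hI (i : (complexify 𝔱).root) :
      (∀ x ∈ rootSpace (complexify 𝔱) i.1, x ∈ I) ↔ ∀ k ∈ S, P.pairing i k = 0 := by
    have := mem_rootSet_invtSubmoduleToLieIdeal q hq (α := i)
    rw [mem_q] at this
    exact this
  obtain ⟨x, hx, hx0⟩ := j.1.exists_ne_zero
  have hpair := pairing_root_equiv hΘ.extend_extend (coe_cartanAction hΘ hΘ𝔱) he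
  -- As `S` is Θ-stable, -Θj is orthogonal to it along with `j`; the ideal thus contains a root
  -- vector of `j` and its conjugate. It then contains the root space of `i₀`, although `i₀` is not
  -- orthogonal to itself.
  have htop : I = ⊤ := by
    refine eq_top_of_mem_of_conj_mem I hx0 ((hI j).mpr hcon x hx) ?_
    refine (hI (P.reflectionPerm (e j) (e j))).mpr (fun k hk ↦ ?_) _ ?_
    · rw [P.pairing_reflectionPerm_self_left, ← hee k, hpair, hcon _ (hSe k hk), neg_zero]
    · have h1 := conj_mem_rootSpace hΘ hΘ𝔱 hx
      convert h1 using 2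
      have h2 : P.root (P.reflectionPerm (e j) (e j)) = -P.root (e j) := by
        rw [P.root_reflectionPerm, P.reflection_apply_self]
      funext h
      exact (LinearMap.congr_fun h2 h).trans (congrArg Neg.neg (he j h))
  have h2 := (hI i₀).mp (fun x _ ↦ htop ▸ trivial) i₀ hi₀
  simp at h2

end Simple

/-! ### Conditions 1 and 2 as a condition on the eigenvalues. -/

section Weights

variable {L : Type*} [LieRing L] [LieAlgebra ℂ L] [FiniteDimensional ℂ L]
  {H : LieSubalgebra ℂ L} [H.IsCartanSubalgebra]

lemma exp_weight_apply_eq_of_forall_root {h h' : H}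
    (hroot : ∀ i : H.root, Complex.exp (i.1 h) = Complex.exp (i.1 h'))
    (χ : LieModule.Weight ℂ H L) : Complex.exp (χ h) = Complex.exp (χ h') := by
  by_cases hχ : χ.IsZero
  · rw [show χ h = 0 from congrFun hχ _, show χ h' = 0 from congrFun hχ _]
  · exact hroot ⟨χ, by simpa [LieSubalgebra.root] using hχ⟩

variable [LieAlgebra.IsKilling ℂ L]

/-- Heights are integers, so every weight is purely imaginary on the Coxeter element. -/
lemma conj_exp_weight_apply_coxeterElement (b : (rootSystem H).Base)
    (χ : LieModule.Weight ℂ H L) :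
    starRingEnd ℂ (Complex.exp (χ (coxeterElement b))) =
      Complex.exp (-χ (coxeterElement b)) := by
  rw [← Complex.exp_conj]
  congr 1
  by_cases hχ : χ.IsZero
  · have h0 : χ (coxeterElement b) = 0 := congrFun hχ _
    simp [h0]
  · have h := root_apply_coxeterElement b ⟨χ, by simpa [LieSubalgebra.root] using hχ⟩
    simp only at h
    rw [h]
    simp [show starRingEnd ℂ (2 : ℂ) = 2 from Complex.conj_ofNat 2]

end Weights

lemma commute_extend_iff (hΘ : IsCartanInvolution Θ) (hΘ𝔱 : ∀ x ∈ 𝔱, Θ x ∈ 𝔱)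
    (b : (rootSystem (complexify 𝔱)).Base) :
    Commute (coxeterAut b) (extend Θ) ↔ ∀ i : (complexify 𝔱).root,
      Complex.exp (i.1 (cartanAction hΘ𝔱 (coxeterElement b))) =
        Complex.exp (i.1 (coxeterElement b)) := by
  have key (χ : LieModule.Weight ℂ (complexify 𝔱) (ℂ ⊗[ℝ] 𝔤)) (x : ℂ ⊗[ℝ] 𝔤)
      (hx : x ∈ rootSpace (complexify 𝔱) χ) :
      coxeterAut b (extend Θ x) =
        Complex.exp (χ (cartanAction hΘ𝔱 (coxeterElement b))) • extend Θ x ∧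
      extend Θ (coxeterAut b x) = Complex.exp (χ (coxeterElement b)) • extend Θ x := by
    rw [coxeterAut_apply_of_mem_rootSpace b hx, map_smul,
      coxeterAut_apply_of_mem_rootSpace b (extend_mem_rootSpace hΘ hΘ𝔱 hx)]
    exact ⟨rfl, rfl⟩
  constructor
  · intro hcomm i
    obtain ⟨x, hx, hx0⟩ := i.1.exists_ne_zero
    have hTx : extend Θ x ≠ 0 := fun h ↦ hx0 (by rw [← hΘ.extend_extend x, h, map_zero])
    have h1 : coxeterAut b (extend Θ x) = extend Θ (coxeterAut b x) :=
      LinearMap.congr_fun hcomm.eq x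
    rw [(key i.1 x hx).1, (key i.1 x hx).2] at h1
    exact smul_left_injective ℂ hTx h1
  · intro h
    refine LinearMap.ext fun x ↦ ?_
    refine weight_induction (H := complexify 𝔱)
      (p := fun x ↦ coxeterAut b (extend Θ x) = extend Θ (coxeterAut b x)) (fun χ x hx ↦ ?_)
      (by simp) (fun x y hx hy ↦ by simp only [map_add, hx, hy]) x
    rw [(key χ x hx).1, (key χ x hx).2, exp_weight_apply_eq_of_forall_root h]

lemma map_realForm_coxeterAut_eq_iff (hΘ : IsCartanInvolution Θ) (hΘ𝔱 : ∀ x ∈ 𝔱, Θ x ∈ 𝔱)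
    (b : (rootSystem (complexify 𝔱)).Base) :
    (realForm 𝔤).map ((coxeterAut b).restrictScalars ℝ) = realForm 𝔤 ↔
      ∀ i : (complexify 𝔱).root,
        Complex.exp (i.1 (cartanAction hΘ𝔱 (coxeterElement b))) =
          Complex.exp (i.1 (coxeterElement b)) := by
  rw [map_realForm_eq_iff (coxeterAut b) (endExp_injective _)]
  have key (χ : LieModule.Weight ℂ (complexify 𝔱) (ℂ ⊗[ℝ] 𝔤)) (x : ℂ ⊗[ℝ] 𝔤)
      (hx : x ∈ rootSpace (complexify 𝔱) χ) :
      coxeterAut b (conj 𝔤 x) =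
        (Complex.exp (χ (cartanAction hΘ𝔱 (coxeterElement b))))⁻¹ • conj 𝔤 x ∧
      conj 𝔤 (coxeterAut b x) = (Complex.exp (χ (coxeterElement b)))⁻¹ • conj 𝔤 x := by
    rw [coxeterAut_apply_of_mem_rootSpace b hx, conj_smul,
      coxeterAut_apply_of_mem_rootSpace b (conj_mem_rootSpace hΘ hΘ𝔱 hx),
      conj_exp_weight_apply_coxeterElement, ← Complex.exp_neg, ← Complex.exp_neg]
    exact ⟨rfl, rfl⟩
  constructor
  · intro hcomm i
    obtain ⟨x, hx, hx0⟩ := i.1.exists_ne_zero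
    have hTx : conj 𝔤 x ≠ 0 := fun h ↦ hx0 (by rw [← conj_conj x, h, map_zero])
    have h1 := hcomm x
    rw [(key i.1 x hx).1, (key i.1 x hx).2] at h1
    exact inv_injective (smul_left_injective ℂ hTx h1)
  · intro h x
    refine weight_induction (H := complexify 𝔱)
      (p := fun x ↦ coxeterAut b (conj 𝔤 x) = conj 𝔤 (coxeterAut b x)) (fun χ x hx ↦ ?_)
      (by simp) (fun x y hx hy ↦ by simp only [map_add, hx, hy]) x
    rw [(key χ x hx).1, (key χ x hx).2, exp_weight_apply_eq_of_forall_root h]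

/-! ### The extended Dynkin diagram and condition 3. -/

section Simple

variable [LieAlgebra.IsSimple ℝ 𝔤]

/-- The negative of a lowest root is maximal, and its orbit under reflections and Θ is orthogonal to
no root, so it attains the greatest height k - 1 whichever component it lies in. -/
lemma IsLowest.height_eq (hΘ : IsCartanInvolution Θ) (hΘ𝔱 : ∀ x ∈ 𝔱, Θ x ∈ 𝔱)
    {b : (rootSystem (complexify 𝔱)).Base} {i : (complexify 𝔱).root} (hi : IsLowest b i) :
    b.height i = 1 - coxeterNumber b := by
  have := nonempty_root (𝔱 := 𝔱)
  let P := rootSystem (complexify 𝔱)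
  let := P.indexNeg
  have hneg (j : (complexify 𝔱).root) : P.root (-j) = -P.root j := by simp
  have hmax : b.IsMaximal (-i) := fun j hj ↦ by
    have h1 : -j = i := hi (-j) (by
      change P.root i - P.root (-j) ∈ _
      change P.root j - P.root (-i) ∈ _ at hj
      rw [hneg, sub_neg_eq_add] at hj ⊢
      rwa [add_comm])
    rw [← h1, neg_neg]
  obtain ⟨e, he, hee⟩ := exists_root_equiv hΘ.extend_extend (coe_cartanAction hΘ hΘ𝔱)
  have hpair := pairing_root_equiv hΘ.extend_extend (coe_cartanAction hΘ hΘ𝔱) he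
  have hpairIn (j k : (complexify 𝔱).root) :
      P.pairingIn ℤ (e j) (e k) = P.pairingIn ℤ j k := by
    apply FaithfulSMul.algebraMap_injective ℤ ℂ
    rw [P.algebraMap_pairingIn, P.algebraMap_pairingIn, hpair]
  obtain ⟨m, hm⟩ := exists_height_eq b
  have h1 := hmax.height_le_of_reflTransGen e hpairIn (fun j ↦ by
    obtain ⟨k, hk, hk'⟩ := exists_pairing_ne_zero hΘ hΘ𝔱 he hee
      (S := {k | Relation.ReflTransGen
        (fun k l ↦ l = e k ∨ ∃ m, l = P.reflectionPerm m k) (-i) k})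
      (i₀ := -i) Relation.ReflTransGen.refl (fun k hk m ↦ hk.tail (Or.inr ⟨m, rfl⟩))
      (fun k hk ↦ hk.tail (Or.inl rfl)) j
    refine ⟨k, hk, fun h ↦ hk' ?_⟩
    rw [← P.algebraMap_pairingIn ℤ, h, map_zero]) m
  have h2 : b.height (-i) = -b.height i := b.height_reflectionPerm_self i
  have h3 := neg_coxeterNumber_lt_height b i
  omega

/-- The nodes of the extended Dynkin diagram are the roots whose height is congruent to `1` modulo
the Coxeter number. -/
lemma mem_extendedNodes_iff (hΘ : IsCartanInvolution Θ) (hΘ𝔱 : ∀ x ∈ 𝔱, Θ x ∈ 𝔱)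
    (b : (rootSystem (complexify 𝔱)).Base) (i : (complexify 𝔱).root) :
    i ∈ extendedNodes b ↔ coxeterNumber b ∣ b.height i - 1 := by
  have := nonempty_root (𝔱 := 𝔱)
  constructor
  · rintro (hi | hi)
    · simp [RootPairing.Base.height_one_of_mem_support hi]
    · rw [hi.height_eq hΘ hΘ𝔱]
      exact ⟨-1, by ring⟩
  · rintro ⟨c, hc⟩
    have h1 := height_lt_coxeterNumber b i
    have h2 := neg_coxeterNumber_lt_height b i
    have h3 := two_le_coxeterNumber b
    have h4 : c < 1 := by nlinarith
    have h5 : -2 < c := by nlinarith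
    obtain rfl | rfl : c = 0 ∨ c = -1 := by omega
    · exact Or.inl (b.mem_support_of_height_eq_one (by omega))
    -- Here the height is 1 - k, the least possible value, so no other root can lie below `i`.
    · refine Or.inr fun j hj ↦ ?_
      obtain ⟨h6, h7⟩ := b.height_le_of_sub_mem_closure hj
      have h8 := neg_coxeterNumber_lt_height b j
      exact h7 (by omega)

lemma permutesExtendedDiagram_iff (hΘ : IsCartanInvolution Θ) (hΘ𝔱 : ∀ x ∈ 𝔱, Θ x ∈ 𝔱)
    (b : (rootSystem (complexify 𝔱)).Base) :
    PermutesExtendedDiagram b (dualAction 𝔱 Θ hΘ𝔱) ↔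
      ∀ i : (complexify 𝔱).root,
        Complex.exp (i.1 (cartanAction hΘ𝔱 (coxeterElement b))) =
          Complex.exp (i.1 (coxeterElement b)) := by
  have := nonempty_root (𝔱 := 𝔱)
  obtain ⟨e, he, hee⟩ := exists_root_equiv hΘ.extend_extend (coe_cartanAction hΘ hΘ𝔱)
  have hpair := pairing_root_equiv hΘ.extend_extend (coe_cartanAction hΘ hΘ𝔱) he
  have hdual (i : (complexify 𝔱).root) :
      dualAction 𝔱 Θ hΘ𝔱 ((rootSystem (complexify 𝔱)).root i) =
        (rootSystem (complexify 𝔱)).root (e i) :=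
    LinearMap.ext fun h ↦ (he i h).symm
  have hexp (i : (complexify 𝔱).root) :
      Complex.exp (i.1 (cartanAction hΘ𝔱 (coxeterElement b))) =
        Complex.exp (i.1 (coxeterElement b)) ↔
      coxeterNumber b ∣ b.height (e i) - b.height i := by
    rw [← he, exp_root_apply_coxeterElement_eq_iff]
  simp_rw [hexp]
  constructor
  · rintro ⟨π, hπ, -⟩ i
    have hsimple (j : (complexify 𝔱).root) (hj : j ∈ b.support) :
        coxeterNumber b ∣ b.height (e j) - 1 := by
      rw [← mem_extendedNodes_iff hΘ hΘ𝔱]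
      have h := hπ ⟨j, Or.inl hj⟩
      rw [hdual] at h
      rw [(rootSystem (complexify 𝔱)).root.injective h]
      exact (π _).2
    obtain ⟨f, -, -, hf⟩ := b.exists_root_eq_sum_int i
    have h1 : b.height (e i) = ∑ j ∈ b.support, f j * b.height (e j) := by
      have h2 : (rootSystem (complexify 𝔱)).root (e i) =
          ∑ j ∈ b.support, f j • (rootSystem (complexify 𝔱)).root (e j) := by
        rw [← hdual, hf, map_sum]
        simp_rw [map_zsmul, hdual]
      -- Evaluation at ∑ ηⱼ reads off heights.
      have h3 := LinearMap.congr_fun h2 (∑ j, dualVector b j)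
      simp only [LinearMap.sum_apply, LinearMap.smul_apply, rootSystem_root_apply,
        LieModule.Weight.toLinear_apply, root_apply_sum_dualVector, zsmul_eq_mul] at h3
      exact_mod_cast h3
    rw [h1, RootPairing.Base.height_eq_sum hf, ← Finset.sum_sub_distrib]
    refine Finset.dvd_sum fun j hj ↦ ?_
    rw [← mul_sub_one]
    exact (hsimple j hj).mul_left _
  · intro h
    have hmem (i : (complexify 𝔱).root) : i ∈ extendedNodes b ↔ e i ∈ extendedNodes b := by
      rw [mem_extendedNodes_iff hΘ hΘ𝔱, mem_extendedNodes_iff hΘ hΘ𝔱]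
      refine (dvd_iff_dvd_of_dvd_sub ?_).symm
      rw [sub_sub_sub_cancel_right]
      exact h i
    -- The Cartan integers are preserved automatically, as Θ is an automorphism.
    exact ⟨e.subtypeEquiv hmem, fun i ↦ hdual i, fun i j ↦ hpair i j⟩

end Simple

end CoxeterReal

end

theorem mainTheorem4 {𝔤 : Type*} [LieRing 𝔤] [LieAlgebra ℝ 𝔤] [FiniteDimensional ℝ 𝔤]
    [LieAlgebra.IsSimple ℝ 𝔤] (𝔱 : LieSubalgebra ℝ 𝔤) [𝔱.IsCartanSubalgebra]
    (Θ : 𝔤 →ₗ⁅ℝ⁆ 𝔤) (hΘ : CoxeterReal.IsCartanInvolution Θ) (hΘ𝔱 : ∀ x ∈ 𝔱, Θ x ∈ 𝔱)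
    (b : (LieAlgebra.IsKilling.rootSystem (CoxeterReal.complexify 𝔱)).Base) :
    List.TFAE [
      (CoxeterReal.realForm 𝔤).map ((CoxeterReal.coxeterAut b).restrictScalars ℝ) =
        CoxeterReal.realForm 𝔤,
      Commute (CoxeterReal.coxeterAut b) (CoxeterReal.extend Θ),
      CoxeterReal.PermutesExtendedDiagram b (CoxeterReal.dualAction 𝔱 Θ hΘ𝔱)] := by
  rw [CoxeterReal.map_realForm_coxeterAut_eq_iff hΘ hΘ𝔱,
    CoxeterReal.commute_extend_iff hΘ hΘ𝔱, CoxeterReal.permutesExtendedDiagram_iff hΘ hΘ𝔱]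
  tfae_finish
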